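/- All graphs are finite and simple. For a graph $G$ and a positive integer $k$, let $R_k(G)$ be the graph whose vertices are the proper colorings of $G$ with colors $\{1,\dots,k\}$, two colorings being adjacent if they differ in color on exactly one vertex. A graph $G$ is \emph{recolorable} if $R_\ell(G)$ is connected for every integer $\ell \ge \chi(G)+1$, where $\chi(G)$ is the chromatic number of $G$. For graphs $H_1,\dots,H_r$, a graph $G$ is \emph{$(H_1,\dots,H_r)$-free} if no induced subgraph of $G$ is isomorphic to any $H_i$. Let $P_5$ and $C_5$ be the path and the cycle on five vertices, and let the \emph{house} be the graph obtained from a 4-cycle by adding one vertex adjacent to exactly two consecutive vertices of the cycle. \textbf{Theorem.} Every $(P_5,\text{house})$-free graph is recolorable if and only if every $(P_5,\text{house},C_5)$-free graph is recolorable. -/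

import Mathlib

universe u

namespace Recoloring

/-- The reconfiguration graph `R_k(G)`: its vertices are the proper `k`-colorings of `G`, and two
colorings are adjacent when they differ in color on exactly one vertex. -/
def reconfigurationGraph {V : Type*} (G : SimpleGraph V) (k : ℕ) :
    SimpleGraph (G.Coloring (Fin k)) where
  Adj a b := ∃! v, a v ≠ b v
  symm := ⟨fun _ _ ⟨v, hv, h⟩ => ⟨v, Ne.symm hv, fun w hw => h w (Ne.symm hw)⟩⟩
  loopless := ⟨fun _ ⟨_, hv, _⟩ => hv rfl⟩

/-- `G` is `k`-mixing if `R_k(G)` is connected. -/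
def IsMixing {V : Type*} (G : SimpleGraph V) (k : ℕ) : Prop :=
  (reconfigurationGraph G k).Connected

/-- `G` is recolorable if it is `l`-mixing for all `l ≥ χ(G) + 1`. -/
def IsRecolorable {V : Type*} (G : SimpleGraph V) : Prop :=
  ∀ l : ℕ, G.chromaticNumber + 1 ≤ (l : ℕ∞) → IsMixing G l

/-- `G` is `H`-free if no induced subgraph of `G` is isomorphic to `H`. -/
def InducedFree {V W : Type*} (H : SimpleGraph W) (G : SimpleGraph V) : Prop :=
  ¬ H.IsIndContained G

/-- The path on five vertices. -/
def P5 : SimpleGraph (Fin 5) := SimpleGraph.pathGraph 5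

/-- The cycle on five vertices. -/
def C5 : SimpleGraph (Fin 5) := SimpleGraph.cycleGraph 5

/-- The house: the 4-cycle `0, 1, 2, 3` together with a vertex `4` adjacent exactly to the two
consecutive vertices `1` and `2`. -/
def house : SimpleGraph (Fin 5) :=
  SimpleGraph.fromEdgeSet {s(0, 1), s(1, 2), s(2, 3), s(3, 0), s(4, 1), s(4, 2)}

end Recoloring

/-! The hypothesis on C5 is removed by induction on the number of vertices. Suppose that G contains
an induced C5, and take a maximal blow-up of it, with arbitrary adjacency inside the parts.
Excluding P5 and the house leaves an outside vertex two options: it sees all or nothing of the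
blow-up, or it could join one of the parts. By maximality the blow-up is therefore a module
(`IsBlowup.isModule`).

A proper module M with a nonadjacent pair can be replaced by a clique of size χ(G[M]). Mixing of G
follows from mixing of G[M] and of the new graph (`IsModule.mixesAbove`). Both are smaller, and both
stay free of P5 and the house, since these two graphs have no twins. This settles the case of a
proper blow-up. If the blow-up is all of G, its parts are modules and the same reduction applies,
unless every part is a clique. Then G has no three pairwise nonadjacent vertices, and such graphs
mix by a direct argument (`NoIndepTriple.mixesAbove`). -/

namespace Recoloring

open Relation

/-! ### Reachability between colorings, and two basic recoloring moves. -/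

section Reconfiguration

variable {V C : Type*} {G : SimpleGraph V}

/-- Two colorings differ on at most one vertex. -/
def Step (f g : G.Coloring C) : Prop := ∃ v, ∀ w, w ≠ v → f w = g w

/-- Colorings connected by a sequence of single-vertex recolorings. -/
def Reach (f g : G.Coloring C) : Prop := ReflTransGen Step f g

/-- Any two colorings with colors in `C` are connected. -/
def Mixing (G : SimpleGraph V) (C : Type*) : Prop := ∀ f g : G.Coloring C, Reach f g

/-- Connectedness of the reconfiguration graph beyond every number of colors that suffices. -/
def MixesAbove (G : SimpleGraph V) : Prop := ∀ c, G.Colorable c → ∀ k, c < k → Mixing G (Fin k)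

theorem Step.symm {f g : G.Coloring C} (h : Step f g) : Step g f :=
  let ⟨v, hv⟩ := h
  ⟨v, fun w hw => (hv w hw).symm⟩

theorem Reach.refl (f : G.Coloring C) : Reach f f := ReflTransGen.refl

theorem Reach.trans {f g h : G.Coloring C} (a : Reach f g) (b : Reach g h) : Reach f h :=
  ReflTransGen.trans a b

theorem Reach.symm {f g : G.Coloring C} (h : Reach f g) : Reach g f := by
  induction h with
  | refl => exact Reach.refl _
  | tail _ s ih => exact (ReflTransGen.single s.symm).trans ih

theorem Reach.lift {W D : Type*} {H : SimpleGraph W} (F : G.Coloring C → H.Coloring D)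
    (hF : ∀ a b, Step a b → Reach (F a) (F b)) {f g : G.Coloring C} (h : Reach f g) :
    Reach (F f) (F g) := by
  induction h with
  | refl => exact Reach.refl _
  | tail _ s ih => exact ih.trans (hF _ _ s)

/-- Steps between equal colorings do not affect reachability. `Connected` includes nonemptiness,
which `Mixing` does not; hence `hne`. -/
theorem mixing_iff {k : ℕ} (hne : Nonempty (G.Coloring (Fin k))) :
    IsMixing G k ↔ Mixing G (Fin k) := by
  have key : ∀ f g : G.Coloring (Fin k), (reconfigurationGraph G k).Reachable f g ↔ Reach f g := by
    intro f g
    rw [SimpleGraph.reachable_iff_reflTransGen]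
    constructor
    · refine ReflTransGen.mono (p := Step) ?_ f g
      rintro a b ⟨v, -, h⟩
      exact ⟨v, fun w hw => by by_contra hne; exact hw (h w hne)⟩
    · intro h
      induction h with
      | refl => exact ReflTransGen.refl
      | @tail a b _ s ih =>
        obtain ⟨v, hv⟩ := s
        by_cases hab : a v = b v
        · have : a = b := by
            ext w
            by_cases hw : w = v
            · rw [hw, hab]
            · rw [hv w hw]
          exact this ▸ ih
        · refine ih.tail ⟨v, hab, fun w hw => ?_⟩
          by_contra h
          exact hw (hv w h)
  constructor
  · intro h f g
    exact (key f g).1 (h.preconnected f g)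
  · intro h
    exact ⟨fun f g => (key f g).2 (h f g)⟩

theorem isRecolorable_iff_mixesAbove [Finite V] : IsRecolorable G ↔ MixesAbove G := by
  have hfin : G.Colorable (G.chromaticNumber.toNat) := G.colorable_chromaticNumber_of_fintype
  have hcast : (G.chromaticNumber.toNat : ℕ∞) = G.chromaticNumber :=
    ENat.natCast_toNat (SimpleGraph.chromaticNumber_ne_top_iff_exists.2 ⟨_, hfin⟩)
  constructor
  · intro h c hc k hk
    refine (mixing_iff (hc.mono hk.le)).1 (h k ?_)
    calc G.chromaticNumber + 1 ≤ (c : ℕ∞) + 1 := by gcongr; exact hc.chromaticNumber_le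
      _ ≤ k := by exact_mod_cast hk
  · intro h k hk
    rw [← hcast] at hk
    have hk' : G.chromaticNumber.toNat < k := by exact_mod_cast hk
    exact (mixing_iff (hfin.mono hk'.le)).2 (h _ hfin k hk')

theorem Mixing.of_equiv {D : Type*} (e : C ≃ D) (h : Mixing G C) : Mixing G D := by
  intro f g
  let F : G.Coloring C → G.Coloring D := fun a =>
    SimpleGraph.Coloring.mk (fun v => e (a v)) fun {v w} hvw => by simpa using a.valid hvw
  let F' : G.Coloring D → G.Coloring C := fun a =>
    SimpleGraph.Coloring.mk (fun v => e.symm (a v)) fun {v w} hvw => by simpa using a.valid hvw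
  have hF : ∀ a, F (F' a) = a := fun a => by
    ext v
    exact e.apply_symm_apply _
  have := Reach.lift F
    (fun a b ⟨v, hv⟩ => ReflTransGen.single ⟨v, fun w hw => congrArg e (hv w hw)⟩) (h (F' f) (F' g))
  rwa [hF, hF] at this

theorem MixesAbove.mixing (h : MixesAbove G) {c : ℕ} (hc : G.Colorable c) [Finite C] (hC : c < Nat.card C) :
    Mixing G C :=
  (h c hc _ hC).of_equiv (Finite.equivFin C).symm

open Classical in
/-- Recolor a set `M` using only colors of `S`, when the outside neighbors of `M` avoid `S`. -/
theorem Reach.of_local (M : Set V) (S : Set C) (hmix : Mixing (G.induce M) S)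
    {f g : G.Coloring C} (hf : ∀ v ∈ M, f v ∈ S) (hg : ∀ v ∈ M, g v ∈ S)
    (hfg : ∀ v, v ∉ M → f v = g v)
    (hout : ∀ v, v ∉ M → ∀ m ∈ M, G.Adj v m → f v ∉ S) : Reach f g := by
  let F : (G.induce M).Coloring S → G.Coloring C := fun a =>
    SimpleGraph.Coloring.mk (fun v => if hv : v ∈ M then (a ⟨v, hv⟩ : C) else f v) (by
      intro v w hvw
      by_cases hv : v ∈ M <;> by_cases hw : w ∈ M
      · simp only [hv, hw, dite_true]
        exact fun h => a.valid (v := ⟨v, hv⟩) (w := ⟨w, hw⟩) hvw (Subtype.ext h)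
      · simp only [hv, hw, dite_true, dite_false]
        exact fun h => hout w hw v hv hvw.symm (h ▸ (a ⟨v, hv⟩).2)
      · simp only [hv, hw, dite_true, dite_false]
        exact fun h => hout v hv w hw hvw (h ▸ (a ⟨w, hw⟩).2)
      · simp only [hv, hw, dite_false]
        exact f.valid hvw)
  let R : ∀ a : G.Coloring C, (∀ v ∈ M, a v ∈ S) → (G.induce M).Coloring S := fun a ha =>
    SimpleGraph.Coloring.mk (fun v => (⟨a v, ha v v.2⟩ : S)) (by
      intro v w hvw h
      exact a.valid hvw (congrArg Subtype.val h))
  have hFf : F (R f hf) = f := by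
    ext v
    change (if hv : v ∈ M then f v else f v) = f v
    split_ifs <;> rfl
  have hFg : F (R g hg) = g := by
    ext v
    change (if hv : v ∈ M then g v else f v) = g v
    split_ifs with hv
    · rfl
    · exact hfg v hv
  have := Reach.lift F (fun a b ⟨v, hv⟩ => ReflTransGen.single ⟨v, fun w hw => by
    change (if hw : w ∈ M then (a ⟨w, hw⟩ : C) else f w) =
      if hw : w ∈ M then (b ⟨w, hw⟩ : C) else f w
    split_ifs with hwM
    · rw [hv ⟨w, hwM⟩ fun h => hw (congrArg Subtype.val h)]
    · rfl⟩) (hmix (R f hf) (R g hg))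
  rwa [hFf, hFg] at this

open Classical in
/-- A set of vertices may be moved to a common color, one vertex at a time. -/
theorem Reach.of_constant [Finite V] {f g : G.Coloring C} (d : C)
    (h : ∀ v, f v = g v ∨ g v = d) : Reach f g := by
  cases nonempty_fintype V
  -- Switching only the vertices of `T` keeps the coloring proper: `g` is proper, so no edge has
  -- both ends moved to `d`.
  let F : Finset V → G.Coloring C := fun T =>
    SimpleGraph.Coloring.mk (fun v => if v ∈ T then g v else f v) (by
      intro v w hvw
      have h1 := f.valid hvw
      have h2 := g.valid hvw
      have hv := h v
      have hw := h w
      split_ifs <;> grind)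
  have key : ∀ T, Reach f (F T) := by
    intro T
    induction T using Finset.induction_on with
    | empty =>
      convert Reach.refl f
      ext v
      change (if v ∈ (∅ : Finset V) then g v else f v) = f v
      simp
    | insert a T ha ih =>
      refine ih.tail ⟨a, fun w hw => ?_⟩
      change (if w ∈ T then g w else f w) = if w ∈ insert a T then g w else f w
      simp [hw]
  convert key Finset.univ
  ext v
  change g v = if v ∈ Finset.univ then g v else f v
  simp

end Reconfiguration

/-! ### Graphs without three pairwise nonadjacent vertices. -/

section IndependenceNumberTwo

variable {V : Type*} {G : SimpleGraph V}

/-- No three vertices are pairwise nonadjacent. -/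
def NoIndepTriple (G : SimpleGraph V) : Prop :=
  ∀ x y z, x ≠ y → x ≠ z → y ≠ z → G.Adj x y ∨ G.Adj x z ∨ G.Adj y z

theorem NoIndepTriple.eq_or_eq_or_eq {C : Type*} (h3 : NoIndepTriple G) (b : G.Coloring C)
    {x y z : V} (hxy : b x = b y) (hxz : b x = b z) : x = y ∨ x = z ∨ y = z := by
  by_contra! h
  rcases h3 x y z h.1 h.2.1 h.2.2 with h | h | h
  · exact b.valid h hxy
  · exact b.valid h hxz
  · exact b.valid h (hxy ▸ hxz)

open Classical in
/-- If `f` uses all its colors, and more of them than `b` has, then some color class of `f` is a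
singleton, which is not a color class of `b`. -/
theorem NoIndepTriple.exists_singleton_class [Finite V] (h3 : NoIndepTriple G) {c k : ℕ}
    (b : G.Coloring (Fin c)) (hck : c < k) (f : G.Coloring (Fin k)) (hf : ∀ d, ∃ v, f v = d) :
    ∃ v w, v ≠ w ∧ b v = b w ∧ ∀ u, f u = f v → u = v := by
  cases nonempty_fintype V
  by_contra! H
  -- Double counting: each of the `k` classes of `f` has weight at least 2, and each class of `b`
  -- has at most two vertices, so weight at most 2. By `H`, singleton classes of `f` are singleton
  -- classes of `b`, which would give 2k ≤ 2c.
  let wt : ∀ {m : ℕ}, (V → Fin m) → V → ℕ := fun g v => if ∀ u, g u = g v → u = v then 2 else 1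
  have hle : ∀ v, wt f v ≤ wt b v := by
    intro v
    simp only [wt]
    split_ifs with h1 h2 h2
    · rfl
    · push Not at h2
      obtain ⟨u, hu, huv⟩ := h2
      obtain ⟨w, hw, hwv⟩ := H v u (Ne.symm huv) hu.symm
      exact absurd (h1 w hw) hwv
    · norm_num
    · rfl
  have hsum : ∑ v, wt f v ≤ ∑ v, wt b v := Finset.sum_le_sum fun v _ => hle v
  rw [← Finset.sum_fiberwise (s := Finset.univ) (g := f) (f := wt f),
    ← Finset.sum_fiberwise (s := Finset.univ) (g := b) (f := wt b)] at hsum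
  have hlow : ∀ d ∈ (Finset.univ : Finset (Fin k)),
      2 ≤ ∑ v with f v = d, wt f v := by
    intro d _
    obtain ⟨v, hv⟩ := hf d
    by_cases h1 : ∀ u, f u = f v → u = v
    · calc 2 = wt f v := by simp only [wt]; rw [if_pos h1]
        _ ≤ _ := Finset.single_le_sum (f := wt f) (fun _ _ => Nat.zero_le _) (by simp [hv])
    · push Not at h1
      obtain ⟨u, hu, huv⟩ := h1
      have hsub : ({u, v} : Finset V) ⊆ Finset.univ.filter fun v => f v = d := by
        intro x hx
        simp only [Finset.mem_insert, Finset.mem_singleton] at hx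
        rcases hx with rfl | rfl <;> simp [hu, hv]
      calc 2 = ∑ x ∈ ({u, v} : Finset V), 1 := by simp [Finset.card_pair huv]
        _ ≤ ∑ x ∈ ({u, v} : Finset V), wt f x := Finset.sum_le_sum fun x _ => by
            grind
        _ ≤ _ := Finset.sum_le_sum_of_subset hsub
  have hup : ∀ d ∈ (Finset.univ : Finset (Fin c)),
      ∑ v with b v = d, wt b v ≤ 2 := by
    intro d _
    by_cases h1 : ∃ v, b v = d ∧ ∀ u, b u = b v → u = v
    · obtain ⟨v, rfl, h1⟩ := h1
      have : (Finset.univ.filter fun u => b u = b v) ⊆ {v} := fun u hu => by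
        simpa using h1 u (by simpa using hu)
      calc _ ≤ ∑ u ∈ {v}, wt b u := Finset.sum_le_sum_of_subset this
        _ ≤ 2 := by
          rw [Finset.sum_singleton]
          simp only [wt]
          grind
    · push Not at h1
      calc _ = ∑ v with b v = d, 1 := Finset.sum_congr rfl fun v hv => by
            obtain ⟨u, hu, huv⟩ := h1 v (by simpa using hv)
            simp only [wt]
            rw [if_neg]
            exact fun h => huv (h u hu)
        _ = (Finset.univ.filter fun v => b v = d).card := by simp
        _ ≤ 2 := by
          by_contra! h
          obtain ⟨x, y, z, hx, hy, hz, hxy, hxz, hyz⟩ := Finset.two_lt_card_iff.1 h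
          simp only [Finset.mem_filter, Finset.mem_univ, true_and] at hx hy hz
          rcases h3.eq_or_eq_or_eq b (hx.trans hy.symm) (hx.trans hz.symm) with h | h | h
          exacts [hxy h, hxz h, hyz h]
  have h1 := Finset.sum_le_sum hlow
  have h2 := Finset.sum_le_sum hup
  simp only [Finset.sum_const, Finset.card_univ, Fintype.card_fin, smul_eq_mul] at h1 h2
  have := h1.trans (hsum.trans h2)
  omega

open Classical in
/-- Some color can be freed, as long as there are more colors than some coloring needs. -/
theorem NoIndepTriple.exists_reach_missing [Finite V] (h3 : NoIndepTriple G) {c k : ℕ}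
    (b : G.Coloring (Fin c)) (hck : c < k) (f : G.Coloring (Fin k)) :
    ∃ g, Reach f g ∧ ∃ d, ∀ v, g v ≠ d := by
  cases nonempty_fintype V
  have : Finite (G.Coloring (Fin k)) :=
    Finite.of_injective (fun (a : G.Coloring (Fin k)) v => a v) DFunLike.coe_injective
  -- Potential: the pairs that are monochromatic under both colorings. A reachable coloring
  -- maximizing it must miss a color.
  let agree : G.Coloring (Fin k) → Finset (V × V) := fun a =>
    Finset.univ.filter fun p => p.1 ≠ p.2 ∧ a p.1 = a p.2 ∧ b p.1 = b p.2
  obtain ⟨g, hg, hmax⟩ := Set.exists_max_image {g | Reach f g} (fun g => (agree g).card)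
    (Set.toFinite _) ⟨f, Reach.refl f⟩
  refine ⟨g, hg, ?_⟩
  by_contra! H
  obtain ⟨v, w, hvw, hb, hv⟩ := h3.exists_singleton_class b hck g H
  -- `w` may take the color of `v`: the two are nonadjacent, having the same color under `b`, and no
  -- other vertex has that color.
  let g' : G.Coloring (Fin k) := SimpleGraph.Coloring.mk (fun u => if u = w then g v else g u) (by
    intro x y hxy
    have h1 := g.valid hxy
    have h2 := b.valid hxy
    have hx := hv x
    have hy := hv y
    grind)
  have hg' : ∀ u, g' u = if u = w then g v else g u := fun _ => rfl
  have hstep : Step g g' := ⟨w, fun u hu => by rw [hg', if_neg hu]⟩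
  have hlt : (agree g).card < (agree g').card := by
    refine Finset.card_lt_card ((Finset.ssubset_iff_of_subset ?_).2 ⟨(v, w), ?_, ?_⟩)
    · rintro ⟨x, y⟩ hxy
      simp only [agree, Finset.mem_filter, Finset.mem_univ, true_and] at hxy ⊢
      refine ⟨hxy.1, ?_, hxy.2.2⟩
      -- No pair is lost: the class of `w` under `b` is just `v` and `w`, and these two had
      -- different colors under `g`.
      have key : ∀ y, y ≠ w → g w = g y → b w = b y → False := by
        intro y hyw hgy hby
        rcases h3.eq_or_eq_or_eq b hb.symm hby with h | h | h
        · exact hvw h.symm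
        · exact hyw h.symm
        · exact hvw (hv w (h ▸ hgy)).symm
      rw [hg', hg']
      have := key x
      have := key y
      grind
    · simp [agree, hvw, hb, hg']
    · simp only [agree, Finset.mem_filter, Finset.mem_univ, true_and, not_and]
      exact fun _ h => absurd (hv w h.symm).symm hvw
  exact absurd (hmax g' (hg.tail hstep)) (not_le.2 hlt)

theorem NoIndepTriple.induce (h3 : NoIndepTriple G) (M : Set V) : NoIndepTriple (G.induce M) :=
  fun x y z hxy hxz hyz => h3 x y z (Subtype.coe_ne_coe.2 hxy) (Subtype.coe_ne_coe.2 hxz)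
    (Subtype.coe_ne_coe.2 hyz)

-- Induction removing one color class `D` of `b`. Once a color `d` is free, all of `D` can move to
-- it. The rest is then colored with k - 1 colors and needs at most c - 1, so it can be rearranged
-- at will by induction. Making it avoid the target color `e` lets `D` move on to `e`, and a last
-- rearrangement yields the fixed coloring `δ`.
open Classical in
theorem NoIndepTriple.mixesAbove {V : Type*} [Finite V] {G : SimpleGraph V} (h3 : NoIndepTriple G) :
    MixesAbove G := by
  induction hn : Nat.card V using Nat.strong_induction_on generalizing V with
  | _ n ih =>
  rintro c ⟨b⟩ k hck
  rcases isEmpty_or_nonempty V with hV | ⟨⟨x⟩⟩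
  · intro f g
    have : f = g := by
      ext v
      exact hV.elim v
    exact this ▸ Reach.refl f
  set D : Set V := {v | b v = b x} with hD
  have hrec : MixesAbove (G.induce Dᶜ) := by
    refine ih _ ?_ (h3.induce _) rfl
    rw [← hn]
    exact Finite.card_subtype_lt (x := x) (by simp [hD])
  let bR : (G.induce Dᶜ).Coloring {i : Fin c // i ≠ b x} :=
    SimpleGraph.Coloring.mk (fun v => ⟨b v, v.2⟩)
      fun {v w} hvw h => b.valid hvw (congrArg Subtype.val h)
  have hc : 0 < c := (b x).pos
  have hcol : (G.induce Dᶜ).Colorable (c - 1) := by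
    have := bR.colorable
    rwa [Fintype.card_subtype_compl, Fintype.card_fin, Fintype.card_subtype_eq] at this
  have hmix : ∀ d : Fin k, Mixing (G.induce Dᶜ) ({i | i ≠ d} : Set (Fin k)) := by
    intro d
    refine hrec.mixing hcol ?_
    have : Nat.card {i : Fin k // i ≠ d} = k - 1 := by
      rw [Nat.card_eq_fintype_card, Fintype.card_subtype_compl, Fintype.card_fin,
        Fintype.card_subtype_eq]
    change c - 1 < Nat.card {i : Fin k // i ≠ d}
    omega
  have hslide : ∀ (d : Fin k) (f g : G.Coloring (Fin k)), (∀ v, f v = d ↔ v ∈ D) →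
      (∀ v, g v = d ↔ v ∈ D) → Reach f g := by
    intro d f g hf hg
    refine Reach.of_local Dᶜ {i | i ≠ d} (hmix d) (fun v hv h => hv ((hf v).1 h))
      (fun v hv h => hv ((hg v).1 h)) ?_ ?_
    · intro v hv
      rw [Set.notMem_compl_iff] at hv
      rw [(hf v).2 hv, (hg v).2 hv]
    · intro v hv m _ _ h
      rw [Set.notMem_compl_iff] at hv
      exact h ((hf v).2 hv)
  let δ : G.Coloring (Fin k) := SimpleGraph.Coloring.mk (fun v => Fin.castLE hck.le (b v))
    fun {v w} hvw h => b.valid hvw (Fin.castLE_injective hck.le h)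
  set e : Fin k := Fin.castLE hck.le (b x)
  have hδ : ∀ v, δ v = e ↔ v ∈ D := fun v => (Fin.castLE_injective hck.le).eq_iff
  have main : ∀ f : G.Coloring (Fin k), Reach f δ := by
    intro f
    obtain ⟨f₁, hf₁, d, hd⟩ := h3.exists_reach_missing b hck f
    let mono : ∀ (d : Fin k) (a : V → Fin k), (∀ v, v ∉ D → a v ≠ d) →
        (∀ v w, v ∉ D → w ∉ D → G.Adj v w → a v ≠ a w) → G.Coloring (Fin k) := fun d a h1 h2 =>
      SimpleGraph.Coloring.mk (fun v => if v ∈ D then d else a v) (by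
        intro v w hvw
        split_ifs with hv hw hw
        · exact absurd (hv.trans (Eq.symm hw)) (b.valid hvw)
        · exact (h1 w hw).symm
        · exact h1 v hv
        · exact h2 v w hv hw hvw)
    have hmono : ∀ d a h1 h2 v, mono d a h1 h2 v = if v ∈ D then d else a v :=
      fun _ _ _ _ _ => rfl
    have hmonoD : ∀ d a h1 h2 v, mono d a h1 h2 v = d ↔ v ∈ D := by
      intro d a h1 h2 v
      rw [hmono d a h1 h2]
      split_ifs with hv
      · simp [hv]
      · simp [hv, h1 v hv]
    have hd₁ : ∀ v, v ∉ D → f₁ v ≠ d := fun v _ => hd v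
    have hd₂ : ∀ v w, v ∉ D → w ∉ D → G.Adj v w → f₁ v ≠ f₁ w := fun v w _ _ h => f₁.valid h
    let f₂ := mono d f₁ hd₁ hd₂
    have h12 : Reach f₁ f₂ := Reach.of_constant d fun v => by
      change f₁ v = (if v ∈ D then d else f₁ v) ∨ (if v ∈ D then d else f₁ v) = d
      split_ifs <;> simp
    -- At least k - 2 ≥ c - 1 colors differ from both `d` and `e`, enough for the remaining classes
    -- of `b`.
    obtain ⟨φ⟩ : Nonempty ({i : Fin c // i ≠ b x} ↪ {i : Fin k // i ∉ ({d, e} : Finset (Fin k))}) := by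
      refine Function.Embedding.nonempty_of_card_le ?_
      rw [Fintype.card_subtype_compl, Fintype.card_fin, Fintype.card_subtype_eq,
        Fintype.card_subtype_compl, Fintype.card_fin, Fintype.card_coe]
      have := Finset.card_le_two (a := d) (b := e)
      omega
    let a : V → Fin k := fun v => if hv : b v ≠ b x then φ ⟨b v, hv⟩ else d
    have ha : ∀ v, v ∉ D → a v ∉ ({d, e} : Finset (Fin k)) := by
      intro v hv
      have hv' : b v ≠ b x := hv
      simp only [a, hv', ne_eq, not_false_eq_true, dite_true]
      exact (φ _).2
    have ha2 : ∀ v w, v ∉ D → w ∉ D → G.Adj v w → a v ≠ a w := by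
      intro v w hv hw hvw h
      have hv' : b v ≠ b x := hv
      have hw' : b w ≠ b x := hw
      simp only [a, hv', hw', ne_eq, not_false_eq_true, dite_true] at h
      exact b.valid hvw (congrArg Subtype.val (φ.injective (Subtype.ext h)))
    have had : ∀ v, v ∉ D → a v ≠ d := fun v hv h => ha v hv (by simp [h])
    have hae : ∀ v, v ∉ D → a v ≠ e := fun v hv h => ha v hv (by simp [h])
    have h23 : Reach f₂ (mono d a had ha2) := 
      hslide d _ _ (hmonoD d f₁ hd₁ hd₂) (hmonoD d a had ha2)
    have h34 : Reach (mono d a had ha2) (mono e a hae ha2) := Reach.of_constant e fun v => by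
      rw [hmono d a had ha2, hmono e a hae ha2]
      split_ifs <;> simp
    have h45 : Reach (mono e a hae ha2) δ := hslide e _ _ (hmonoD e a hae ha2) hδ
    exact hf₁.trans (h12.trans (h23.trans (h34.trans h45)))
  exact fun f g => (main f).trans (main g).symm

end IndependenceNumberTwo

/-! ### Replacing a module by a clique. -/

section Modules

variable {V C : Type*} {G : SimpleGraph V} {M : Set V} {q : ℕ}

/-- A module (homogeneous set): an outside vertex sees all of `M` or nothing of it. -/
def IsModule (G : SimpleGraph V) (M : Set V) : Prop :=
  ∀ v, v ∉ M → ∀ m ∈ M, ∀ m' ∈ M, G.Adj v m → G.Adj v m'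

/-- The graph obtained by replacing the module `M` by a clique on `q` vertices. -/
def cliqueReplace (G : SimpleGraph V) (M : Set V) (q : ℕ) :
    SimpleGraph ((Mᶜ : Set V) ⊕ Fin q) where
  Adj
    | .inl a, .inl b => G.Adj a b
    | .inl a, .inr _ => ∃ m ∈ M, G.Adj a m
    | .inr _, .inl a => ∃ m ∈ M, G.Adj a m
    | .inr i, .inr j => i ≠ j
  symm := ⟨by
    rintro (a | i) (b | j) h
    · exact h.symm
    · exact h
    · exact h
    · exact Ne.symm h⟩
  loopless := ⟨by
    rintro (a | i) h
    · exact h.ne rfl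
    · exact h rfl⟩

/-- Color the replacing clique with colors which occur on the module. -/
def IsModule.collapse (hM : IsModule G M) (f : G.Coloring C) (e : Fin q ↪ C)
    (he : ∀ i, ∃ m ∈ M, f m = e i) : (cliqueReplace G M q).Coloring C :=
  SimpleGraph.Coloring.mk (Sum.elim (fun a => f a) e) (by
    have key : ∀ (a : (Mᶜ : Set V)) (i : Fin q), (∃ m ∈ M, G.Adj a m) → f a ≠ e i := by
      rintro a i ⟨m, hm, ham⟩
      obtain ⟨m', hm', h⟩ := he i
      exact h ▸ f.valid (hM a a.2 m hm m' hm' ham)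
    rintro (a | i) (b | j) h
    · exact f.valid h
    · exact key a j h
    · exact (key b i h).symm
    · exact fun h' => h (e.injective h'))

open Classical in
/-- Color the module by giving each class of a `q`-coloring of it the color of a clique vertex. -/
noncomputable def expand (p : (G.induce M).Coloring (Fin q))
    (h : (cliqueReplace G M q).Coloring C) : G.Coloring C :=
  SimpleGraph.Coloring.mk
    (fun v => if hv : v ∈ M then h (.inr (p ⟨v, hv⟩)) else h (.inl ⟨v, hv⟩)) (by
      intro v w hvw
      by_cases hv : v ∈ M <;> by_cases hw : w ∈ M <;>
        simp only [hv, hw, dite_true, dite_false]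
      · exact h.valid (v := .inr (p ⟨v, hv⟩)) (w := .inr (p ⟨w, hw⟩))
          (p.valid (v := ⟨v, hv⟩) (w := ⟨w, hw⟩) hvw)
      · exact h.valid (v := .inr (p ⟨v, hv⟩)) (w := .inl ⟨w, hw⟩) ⟨v, hv, hvw.symm⟩
      · exact h.valid (v := .inl ⟨v, hv⟩) (w := .inr (p ⟨w, hw⟩)) ⟨w, hw, hvw⟩
      · exact h.valid (v := .inl ⟨v, hv⟩) (w := .inl ⟨w, hw⟩) hvw)

theorem expand_of_mem (p : (G.induce M).Coloring (Fin q)) (h : (cliqueReplace G M q).Coloring C)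
    {v : V} (hv : v ∈ M) : expand p h v = h (.inr (p ⟨v, hv⟩)) :=
  dif_pos hv

theorem expand_of_notMem (p : (G.induce M).Coloring (Fin q))
    (h : (cliqueReplace G M q).Coloring C) {v : V} (hv : v ∉ M) :
    expand p h v = h (.inl ⟨v, hv⟩) :=
  dif_neg hv

/-- Recoloring one clique vertex lifts to moving a whole class of `p` to a single color, which
`Reach.of_constant` does vertex by vertex. -/
theorem Reach.expand [Finite V] (p : (G.induce M).Coloring (Fin q))
    {h h' : (cliqueReplace G M q).Coloring C} (hr : Reach h h') :
    Reach (expand p h) (expand p h') := by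
  refine hr.lift (Recoloring.expand p) ?_
  rintro a b ⟨x, hx⟩
  refine Reach.of_constant (b x) fun v => ?_
  by_cases hv : v ∈ M
  · rw [expand_of_mem p a hv, expand_of_mem p b hv]
    by_cases h : Sum.inr (p ⟨v, hv⟩) = x
    · exact Or.inr (by rw [h])
    · exact Or.inl (hx _ h)
  · rw [expand_of_notMem p a hv, expand_of_notMem p b hv]
    by_cases h : Sum.inl ⟨v, hv⟩ = x
    · exact Or.inr (by rw [h])
    · exact Or.inl (hx _ h)

/-- The number of colors on `M` is at least the number needed. -/
theorem le_card_image [Finite V] (hmin : ∀ n, (G.induce M).Colorable n → q ≤ n)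
    (f : G.Coloring C) : q ≤ Nat.card (f '' M) := by
  cases nonempty_fintype V
  have : Finite (f '' M) := (M.toFinite.image f).to_subtype
  cases nonempty_fintype (f '' M)
  rw [Nat.card_eq_fintype_card]
  refine hmin _ (SimpleGraph.Coloring.colorable (SimpleGraph.Coloring.mk
    (fun v : M => (⟨f v, v, v.2, rfl⟩ : f '' M)) ?_))
  exact fun {v w} hvw h => f.valid hvw (congrArg Subtype.val h)

theorem exists_colors_on [Finite V] (hmin : ∀ n, (G.induce M).Colorable n → q ≤ n)
    (f : G.Coloring C) : ∃ e : Fin q ↪ C, ∀ i, ∃ m ∈ M, f m = e i := by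
  have : Finite (f '' M) := (M.toFinite.image f).to_subtype
  cases nonempty_fintype (f '' M)
  obtain ⟨e⟩ : Nonempty (Fin q ↪ f '' M) := by
    refine Function.Embedding.nonempty_of_card_le ?_
    rw [Fintype.card_fin, ← Nat.card_eq_fintype_card]
    exact le_card_image hmin f
  exact ⟨e.trans (Function.Embedding.subtype _), fun i => (e i).2⟩

theorem IsModule.colorable_cliqueReplace [Finite V] (hM : IsModule G M)
    (hmin : ∀ n, (G.induce M).Colorable n → q ≤ n) {c : ℕ} (hc : G.Colorable c) :
    (cliqueReplace G M q).Colorable c := by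
  obtain ⟨f⟩ := hc
  obtain ⟨e, he⟩ := exists_colors_on hmin f
  exact ⟨hM.collapse f e he⟩

/-- Every coloring reaches one which uses only `q` colors on the module. -/
theorem IsModule.exists_reach_expand [Finite V] (hM : IsModule G M)
    (p₀ : (G.induce M).Coloring (Fin q)) (hmin : ∀ n, (G.induce M).Colorable n → q ≤ n)
    (hmix : MixesAbove (G.induce M)) (f : G.Coloring C) :
    ∃ (p : (G.induce M).Coloring (Fin q)) (h : (cliqueReplace G M q).Coloring C),
      Reach f (expand p h) := by
  have : Finite (f '' M) := (M.toFinite.image f).to_subtype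
  -- With exactly `q` colors on `M`, `f` is already an expansion, `p` being read off from it. With
  -- more, `M` mixes within its own colors, which its outside neighbors avoid because `M` is a
  -- module.
  rcases (le_card_image hmin f).eq_or_lt with hq | hq
  · let e : Fin q ≃ f '' M := (finCongr hq).trans (Finite.equivFin _).symm
    let p : (G.induce M).Coloring (Fin q) :=
      SimpleGraph.Coloring.mk (fun v => e.symm ⟨f v, v, v.2, rfl⟩)
        fun {v w} hvw h => f.valid hvw (congrArg Subtype.val (e.symm.injective h))
    refine ⟨p, hM.collapse f (e.toEmbedding.trans (Function.Embedding.subtype _))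
      fun i => (e i).2, ?_⟩
    convert Reach.refl f
    ext v
    by_cases hv : v ∈ M
    · rw [expand_of_mem _ _ hv]
      exact congrArg Subtype.val (e.apply_symm_apply ⟨f v, v, hv, rfl⟩)
    · rw [expand_of_notMem _ _ hv]
      rfl
  · obtain ⟨e, he⟩ := exists_colors_on hmin f
    refine ⟨p₀, hM.collapse f e he, ?_⟩
    refine Reach.of_local M (f '' M) (hmix.mixing ⟨p₀⟩ hq) (fun v hv => ⟨v, hv, rfl⟩) ?_ ?_ ?_
    · intro v hv
      rw [expand_of_mem _ _ hv]
      exact he _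
    · intro v hv
      rw [expand_of_notMem _ _ hv]
      rfl
    · rintro v hv m hm hvm ⟨m', hm', h⟩
      exact f.valid (hM v hv m hm m' hm' hvm) h.symm

/-- A graph mixes if a module of it does, and so does the graph in which this module is replaced
by a clique with the same chromatic number. -/
theorem IsModule.mixesAbove [Finite V] (hM : IsModule G M) (hq : (G.induce M).Colorable q)
    (hmin : ∀ n, (G.induce M).Colorable n → q ≤ n) (hmix : MixesAbove (G.induce M))
    (hmix' : MixesAbove (cliqueReplace G M q)) : MixesAbove G := by
  intro c hc k hck
  have hc' := hM.colorable_cliqueReplace hmin hc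
  obtain ⟨δ₀⟩ := hc'
  obtain ⟨p₀⟩ := hq
  let δ : (cliqueReplace G M q).Coloring (Fin k) :=
    SimpleGraph.Coloring.mk (fun v => Fin.castLE hck.le (δ₀ v))
      fun {v w} hvw h => δ₀.valid hvw (Fin.castLE_injective hck.le h)
  -- `δ` uses only the first `c` colors, so `d` is spare. Together with the `q` clique colors it
  -- gives q + 1 colors for `M`, enough to pass from the partition `p` to `p₀`.
  let d : Fin k := ⟨c, hck⟩
  have hδ : ∀ x, δ x ≠ d := fun x h => (δ₀ x).2.ne (congrArg Fin.val h)
  let S : Set (Fin k) := insert d (Set.range fun i => δ (.inr i))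
  have hinj : Function.Injective fun i : Fin q => δ (.inr i) := by
    intro i j h
    by_contra hij
    exact δ.valid (v := .inr i) (w := .inr j) hij h
  have hS : Nat.card S = q + 1 := by
    rw [Nat.card_coe_set_eq, Set.ncard_insert_of_notMem, ← Nat.card_coe_set_eq,
      Nat.card_range_of_injective hinj, Nat.card_fin]
    rintro ⟨i, hi⟩
    exact hδ _ hi
  have main : ∀ f : G.Coloring (Fin k), Reach f (Recoloring.expand p₀ δ) := by
    intro f
    obtain ⟨p, h, hf⟩ := hM.exists_reach_expand p₀ hmin hmix f
    refine hf.trans ((Reach.expand p (hmix' c ⟨δ₀⟩ k hck h δ)).trans ?_)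
    refine Reach.of_local M S (hmix.mixing ⟨p₀⟩ (by omega)) ?_ ?_ ?_ ?_
    · intro v hv
      rw [expand_of_mem _ _ hv]
      exact Or.inr ⟨_, rfl⟩
    · intro v hv
      rw [expand_of_mem _ _ hv]
      exact Or.inr ⟨_, rfl⟩
    · intro v hv
      rw [expand_of_notMem _ _ hv, expand_of_notMem _ _ hv]
    · rintro v hv m hm hvm h
      rw [expand_of_notMem _ _ hv] at h
      rcases h with h | ⟨i, hi⟩
      · exact hδ _ h
      · exact δ.valid (v := .inl ⟨v, hv⟩) (w := .inr i) ⟨m, hm, hvm⟩ hi.symm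
  exact fun f g => (main f).trans (main g).symm

/-- No two vertices have the same further neighbors. -/
def NoTwins {W : Type*} (H : SimpleGraph W) : Prop :=
  ∀ x y, x ≠ y → ∃ z, z ≠ x ∧ z ≠ y ∧ ¬(H.Adj z x ↔ H.Adj z y)

open Classical in
/-- Replacing a module by a clique creates no induced copies of graphs without twins. -/
theorem IsModule.inducedFree_cliqueReplace {W : Type*} {H : SimpleGraph W} (hH : NoTwins H)
    (hM : IsModule G M) (hne : M.Nonempty) (hG : InducedFree H G) :
    InducedFree H (cliqueReplace G M q) := by
  rintro ⟨φ⟩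
  obtain ⟨m, hm⟩ := hne
  -- Clique vertices are twins, so a copy of `H` contains at most one of them; `m` can stand in for
  -- it in `G`.
  have huniq : ∀ x y i j, φ x = .inr i → φ y = .inr j → x = y := by
    intro x y i j hx hy
    by_contra hxy
    obtain ⟨z, hzx, hzy, hz⟩ := hH x y hxy
    have hx' := φ.injective.ne hzx
    have hy' := φ.injective.ne hzy
    rw [hx] at hx'
    rw [hy] at hy'
    rw [← φ.map_adj_iff, ← φ.map_adj_iff, hx, hy] at hz
    cases hφ : φ z with
    | inl a =>
      rw [hφ] at hz
      exact hz Iff.rfl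
    | inr l =>
      rw [hφ] at hz hx' hy'
      exact hz ⟨fun _ h => hy' (congrArg Sum.inr h), fun _ h => hx' (congrArg Sum.inr h)⟩
  let τ : (Mᶜ : Set V) ⊕ Fin q → V := Sum.elim (fun a => a) (fun _ => m)
  have hτ : ∀ x, (x : (Mᶜ : Set V)).1 ≠ m := fun x h => x.2 (h ▸ hm)
  refine hG ⟨⟨⟨fun x => τ (φ x), ?_⟩, ?_⟩⟩
  · intro x y h
    dsimp only at h
    cases hx : φ x with
    | inl a =>
      cases hy : φ y with
      | inl b =>
        rw [hx, hy] at h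
        exact φ.injective (by rw [hx, hy, Subtype.ext (show (a : V) = b from h)])
      | inr j =>
        rw [hx, hy] at h
        exact absurd h (hτ a)
    | inr i =>
      cases hy : φ y with
      | inl b =>
        rw [hx, hy] at h
        exact absurd h.symm (hτ b)
      | inr j => exact huniq x y i j hx hy
  · intro x y
    change G.Adj (τ (φ x)) (τ (φ y)) ↔ H.Adj x y
    rw [← φ.map_adj_iff]
    cases hx : φ x with
    | inl a =>
      cases hy : φ y with
      | inl b => exact Iff.rfl
      | inr j => exact ⟨fun h => ⟨m, hm, h⟩, fun ⟨m', hm', h⟩ => hM a a.2 m' hm' m hm h⟩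
    | inr i =>
      cases hy : φ y with
      | inl b =>
        exact ⟨fun h => ⟨m, hm, h.symm⟩, fun ⟨m', hm', h⟩ => (hM b b.2 m' hm' m hm h).symm⟩
      | inr j =>
        have := huniq x y i j hx hy
        subst this
        rw [hx] at hy
        rw [Sum.inr.inj hy]
        exact ⟨fun h => absurd rfl h.ne, fun h => absurd rfl h.ne⟩

theorem InducedFree.induce {W : Type*} {H : SimpleGraph W} (h : InducedFree H G) (M : Set V) :
    InducedFree H (G.induce M) := fun ⟨φ⟩ =>
  h ⟨φ.trans (SimpleGraph.Embedding.induce M)⟩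

end Modules

/-! ### How a vertex attaches to an induced 5-cycle. -/

section FiveVertexGraphs

theorem P5_adj (i j : Fin 5) : P5.Adj i j ↔ i.val + 1 = j.val ∨ j.val + 1 = i.val :=
  SimpleGraph.pathGraph_adj

theorem C5_adj (i j : Fin 5) : C5.Adj i j ↔ i - j = 1 ∨ j - i = 1 :=
  SimpleGraph.cycleGraph_adj

theorem house_adj (i j : Fin 5) : house.Adj i j ↔
    s(i, j) ∈ ({s(0, 1), s(1, 2), s(2, 3), s(3, 0), s(4, 1), s(4, 2)} : Finset (Sym2 (Fin 5))) := by
  rw [house, SimpleGraph.fromEdgeSet_adj]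
  constructor
  · rintro ⟨h, -⟩
    simpa using h
  · intro h
    refine ⟨by simpa using h, ?_⟩
    rintro rfl
    revert h
    revert i
    decide

theorem noTwins_P5 : NoTwins P5 := by
  simp only [NoTwins, P5_adj]
  decide

theorem noTwins_house : NoTwins house := by
  simp only [NoTwins, house_adj]
  decide

/-- Vertices with a common image would be twins in `H`, so checking adjacencies is enough to exhibit
an induced copy. -/
theorem NoTwins.injective {V W : Type*} {G : SimpleGraph V} {H : SimpleGraph W} (hH : NoTwins H)
    {f : W → V} (hf : ∀ x y, G.Adj (f x) (f y) ↔ H.Adj x y) : Function.Injective f := by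
  intro x y hxy
  by_contra hne
  obtain ⟨z, -, -, hz⟩ := hH x y hne
  exact hz (by rw [← hf, ← hf, hxy])

theorem InducedFree.not_adj_iff {V W : Type*} {G : SimpleGraph V} {H : SimpleGraph W}
    (hG : InducedFree H G) (hH : NoTwins H) (f : W → V) :
    ¬ ∀ x y, G.Adj (f x) (f y) ↔ H.Adj x y :=
  fun hf => hG ⟨⟨⟨f, hH.injective hf⟩, hf _ _⟩⟩

/-- The neighborhoods on a 5-cycle which a further vertex may have in a graph without induced
`P5` and house. -/
def Attaches (N : Fin 5 → Bool) : Prop :=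
  ∀ i, ¬(N i = true ∧ N (i + 1) = false ∧ N (i + 2) = false ∧ N (i + 3) = false) ∧
    ¬(N i = false ∧ N (i + 1) = true ∧ N (i + 2) = true ∧ N (i + 4) = true)

instance : DecidablePred Attaches := fun N => by unfold Attaches; infer_instance

/-- Adjacency in the 5-cycle as a Boolean. -/
def cycleAdj (i j : Fin 5) : Bool := decide (i - j = 1 ∨ j - i = 1)

theorem cycleAdj_eq_true {i j : Fin 5} : cycleAdj i j = true ↔ C5.Adj i j := by
  rw [C5_adj, cycleAdj, decide_eq_true_iff]

/-- A check of all 32 patterns. In the second case the vertex behaves like a copy of cycle vertex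
`i`; its adjacency to `i` itself is free. -/
theorem Attaches.cases {N : Fin 5 → Bool} (h : Attaches N) :
    (∃ a, ∀ i, N i = a) ∨ ∃ i, ∀ j, j ≠ i → N j = cycleAdj i j := by
  have key : ∀ a b c d e : Bool, Attaches ![a, b, c, d, e] →
      (∃ a', ∀ i, ![a, b, c, d, e] i = a') ∨
        ∃ i, ∀ j, j ≠ i → ![a, b, c, d, e] j = cycleAdj i j := by
    decide
  have hN : N = ![N 0, N 1, N 2, N 3, N 4] := by
    ext i
    fin_cases i <;> rfl
  rw [hN] at h ⊢
  exact key _ _ _ _ _ h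

/-- This and the next lemma carry a pattern over when one representative of a blow-up part is
exchanged for another. -/
theorem Attaches.eq_of_forall_ne {N : Fin 5 → Bool} (h : Attaches N) {j : Fin 5} {a : Bool}
    (hN : ∀ l, l ≠ j → N l = a) : N j = a := by
  have key : ∀ (j : Fin 5) (a b : Bool), Attaches (fun l => if l = j then b else a) → b = a := by
    decide
  refine key j a (N j) ?_
  convert h with l
  split_ifs with hl
  · rw [hl]
  · exact (hN l hl).symm

theorem Attaches.eq_cycleAdj {N : Fin 5 → Bool} (h : Attaches N) {i j : Fin 5} (hij : i ≠ j)
    (hN : ∀ l, l ≠ i → l ≠ j → N l = cycleAdj i l) : N j = cycleAdj i j := by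
  have key : ∀ (i j : Fin 5) (a b : Bool), i ≠ j →
      Attaches (fun l => if l = j then b else if l = i then a else cycleAdj i l) →
        b = cycleAdj i j := by
    decide
  refine key i j (N i) (N j) hij ?_
  convert h with l
  split_ifs with hl hl'
  · rw [hl]
  · rw [hl']
  · exact (hN l hl' hl).symm

open Classical in
theorem attaches_of_inducedFree {V : Type*} {G : SimpleGraph V} (hP : InducedFree P5 G)
    (hH : InducedFree house G) {t : Fin 5 → V} (ht : ∀ i j, G.Adj (t i) (t j) ↔ C5.Adj i j)
    (v : V) : Attaches fun i => decide (G.Adj v (t i)) := by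
  intro i
  have hrot : ∀ i a b : Fin 5, C5.Adj (i + a) (i + b) ↔ C5.Adj a b := by
    simp only [C5_adj]
    decide
  -- Rotating the cycle reduces to `i = 0`.
  obtain ⟨s, hs⟩ : ∃ s : Fin 5 → V, s = fun a => t (i + a) := ⟨_, rfl⟩
  have hst : ∀ a, t (i + a) = s a := fun a => by rw [hs]
  have hst0 : t i = s 0 := by rw [← hst, add_zero]
  have hsadj : ∀ a b, G.Adj (s a) (s b) ↔ (a - b = 1 ∨ b - a = 1) := by
    intro a b
    rw [hs, ht, hrot, C5_adj]
  simp only [decide_eq_true_eq, decide_eq_false_iff_not, hst, hst0]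
  constructor
  · rintro ⟨h0, h1, h2, h3⟩
    refine hP.not_adj_iff noTwins_P5 ![v, s 0, s 1, s 2, s 3] ?_
    intro x y
    rw [P5_adj]
    fin_cases x <;> fin_cases y <;>
      simp [hsadj, h0, h1, h2, h3, G.adj_comm _ v] <;> decide
  · rintro ⟨h0, h1, h2, h4⟩
    refine hH.not_adj_iff noTwins_house ![s 4, v, s 1, s 0, s 2] ?_
    intro x y
    rw [house_adj]
    fin_cases x <;> fin_cases y <;>
      simp [hsadj, h0, h1, h2, h4, G.adj_comm _ v] <;> decide

end FiveVertexGraphs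

/-! ### Maximal blow-ups of the 5-cycle. -/

section Blowup

variable {V : Type*} {G : SimpleGraph V}

/-- The vertices labelled by `c` induce a blow-up of the 5-cycle with nonempty parts. -/
structure IsBlowup (G : SimpleGraph V) (c : V → Option (Fin 5)) : Prop where
  adj_iff : ∀ u v i j, c u = some i → c v = some j → i ≠ j → (G.Adj u v ↔ C5.Adj i j)
  exists_label : ∀ i, ∃ v, c v = some i

theorem IsBlowup.adj_iff_of_transversal {c : V → Option (Fin 5)} (hc : IsBlowup G c)
    {t : Fin 5 → V} (ht : ∀ i, c (t i) = some i) (i j : Fin 5) :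
    G.Adj (t i) (t j) ↔ C5.Adj i j := by
  by_cases hij : i = j
  · subst hij
    exact iff_of_false (G.loopless.irrefl _) (C5.loopless.irrefl _)
  · exact hc.adj_iff _ _ i j (ht i) (ht j) hij

open Classical in
theorem exists_isBlowup (h : ¬ InducedFree C5 G) : ∃ c, IsBlowup G c := by
  obtain ⟨φ⟩ := not_not.1 h
  have key : ∀ v i, (if h : ∃ i, φ i = v then some h.choose else none) = some i → φ i = v := by
    intro v i hi
    split_ifs at hi with h
    rw [← Option.some.inj hi]
    exact h.choose_spec
  refine ⟨fun v => if h : ∃ i, φ i = v then some h.choose else none, ?_, ?_⟩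
  · intro u v i j hu hv _
    rw [← key u i hu, ← key v j hv]
    exact φ.map_adj_iff
  · intro i
    have h : ∃ j, φ j = φ i := ⟨i, rfl⟩
    refine ⟨φ i, ?_⟩
    rw [dif_pos h, φ.injective h.choose_spec]

theorem exists_maximal_isBlowup [Finite V] (h : ¬ InducedFree C5 G) :
    ∃ c, IsBlowup G c ∧ ∀ c', IsBlowup G c' → {v | c' v ≠ none}.ncard ≤ {v | c v ≠ none}.ncard :=
  Set.exists_max_image {c | IsBlowup G c} (fun c => {v | c v ≠ none}.ncard) (Set.toFinite _)
    (exists_isBlowup h)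

open Classical in
theorem IsBlowup.isModule [Finite V] (hP : InducedFree P5 G) (hH : InducedFree house G)
    {c : V → Option (Fin 5)} (hc : IsBlowup G c)
    (hmax : ∀ c', IsBlowup G c' → {v | c' v ≠ none}.ncard ≤ {v | c v ≠ none}.ncard) :
    IsModule G {v | c v ≠ none} := by
  intro v hv
  have hv : c v = none := by simpa using hv
  choose t ht using hc.exists_label
  -- Putting `u` in place of the representative of its part gives another induced 5-cycle.
  have hatt : ∀ u j, c u = some j →
      Attaches fun i => decide (G.Adj v (Function.update t j u i)) := by
    intro u j hu
    refine attaches_of_inducedFree hP hH (hc.adj_iff_of_transversal ?_) v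
    intro i
    by_cases hij : i = j
    · rw [hij, Function.update_self, hu]
    · rw [Function.update_of_ne hij, ht]
  have hatt₀ : Attaches fun i => decide (G.Adj v (t i)) := by
    simpa using hatt (t 0) 0 (ht 0)
  rcases hatt₀.cases with ⟨a, ha⟩ | ⟨i, hi⟩
  · have key : ∀ u, c u ≠ none → decide (G.Adj v u) = a := by
      intro u hu
      obtain ⟨j, hj⟩ := Option.ne_none_iff_exists'.1 hu
      have := (hatt u j hj).eq_of_forall_ne (j := j) (a := a) fun l hl => by
        rw [Function.update_of_ne hl]
        exact ha l
      simpa using this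
    intro m hm m' hm' h
    have h1 := key m hm
    have h2 := key m' hm'
    rw [← h2, decide_eq_decide] at h1
    exact h1.1 h
  · exfalso
    have key : ∀ u j, c u = some j → i ≠ j → (G.Adj v u ↔ C5.Adj i j) := by
      intro u j hu hij
      have := (hatt u j hu).eq_cycleAdj hij fun l hli hlj => by
        rw [Function.update_of_ne hlj]
        exact hi l hli
      rw [Function.update_self] at this
      rw [← cycleAdj_eq_true, ← this, decide_eq_true_iff]
    -- `v` is adjacent to the other parts exactly as part `i` is, and adjacency inside a part is
    -- unrestricted, so `v` can join it, against maximality.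
    have hb : IsBlowup G (Function.update c v (some i)) := by
      refine ⟨?_, ?_⟩
      · intro x y j l hx hy hjl
        by_cases hxv : x = v
        · subst hxv
          rw [Function.update_self, Option.some_inj] at hx
          subst hx
          have hyx : y ≠ x := by
            rintro rfl
            rw [Function.update_self, Option.some_inj] at hy
            exact hjl hy
          rw [Function.update_of_ne hyx] at hy
          exact key y l hy hjl
        · rw [Function.update_of_ne hxv] at hx
          by_cases hyv : y = v
          · subst hyv
            rw [Function.update_self, Option.some_inj] at hy
            subst hy
            rw [G.adj_comm, C5.adj_comm]
            exact key x j hx hjl.symm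
          · rw [Function.update_of_ne hyv] at hy
            exact hc.adj_iff x y j l hx hy hjl
      · intro j
        refine ⟨t j, ?_⟩
        rw [Function.update_of_ne, ht]
        intro h
        have := ht j
        rw [h, hv] at this
        cases this
    refine absurd (hmax _ hb) (not_le.2 (Set.ncard_lt_ncard ?_ (Set.toFinite _)))
    refine (Set.ssubset_iff_of_subset ?_).2 ⟨v, by simp, by simp [hv]⟩
    intro u hu
    change Function.update c v (some i) u ≠ none
    rwa [Function.update_of_ne]
    rintro rfl
    exact hu hv

theorem IsBlowup.isModule_part {c : V → Option (Fin 5)} (hc : IsBlowup G c)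
    (huniv : ∀ v, c v ≠ none) (i : Fin 5) : IsModule G {v | c v = some i} := by
  intro v hv m hm m' hm' h
  obtain ⟨j, hj⟩ := Option.ne_none_iff_exists'.1 (huniv v)
  have hji : j ≠ i := by
    rintro rfl
    exact hv hj
  rw [hc.adj_iff v m j i hj hm hji] at h
  rwa [hc.adj_iff v m' j i hj hm' hji]

/-- C5 has independence number 2, and clique parts cannot contribute two independent vertices. -/
theorem IsBlowup.noIndepTriple {c : V → Option (Fin 5)} (hc : IsBlowup G c)
    (huniv : ∀ v, c v ≠ none)
    (hclique : ∀ u v i, c u = some i → c v = some i → u ≠ v → G.Adj u v) : NoIndepTriple G := by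
  have key : ∀ i j l : Fin 5, i ≠ j → i ≠ l → j ≠ l → C5.Adj i j ∨ C5.Adj i l ∨ C5.Adj j l := by
    simp only [C5_adj]
    decide
  intro x y z hxy hxz hyz
  obtain ⟨i, hi⟩ := Option.ne_none_iff_exists'.1 (huniv x)
  obtain ⟨j, hj⟩ := Option.ne_none_iff_exists'.1 (huniv y)
  obtain ⟨l, hl⟩ := Option.ne_none_iff_exists'.1 (huniv z)
  by_cases hij : i = j
  · exact Or.inl (hclique x y i hi (hij ▸ hj) hxy)
  by_cases hil : i = l
  · exact Or.inr (Or.inl (hclique x z i hi (hil ▸ hl) hxz))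
  by_cases hjl : j = l
  · exact Or.inr (Or.inr (hclique y z j hj (hjl ▸ hl) hyz))
  rw [hc.adj_iff x y i j hi hj hij, hc.adj_iff x z i l hi hl hil, hc.adj_iff y z j l hj hl hjl]
  exact key i j l hij hil hjl

/-- Only a complete graph needs as many colors as it has vertices, so a nonadjacent pair in `M`
makes the clique smaller than `M`. -/
theorem card_cliqueReplace_lt [Finite V] {M : Set V} {x y : V} (hx : x ∈ M) (hy : y ∈ M)
    (hxy : x ≠ y) (hadj : ¬ G.Adj x y) :
    Nat.card ((Mᶜ : Set V) ⊕ Fin (G.induce M).chromaticNumber.toNat) < Nat.card V := by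
  cases nonempty_fintype M
  have hcol : (G.induce M).Colorable (G.induce M).chromaticNumber.toNat :=
    SimpleGraph.colorable_chromaticNumber_of_fintype _
  have hcast : ((G.induce M).chromaticNumber.toNat : ℕ∞) = (G.induce M).chromaticNumber :=
    ENat.natCast_toNat (SimpleGraph.chromaticNumber_ne_top_iff_exists.2 ⟨_, hcol⟩)
  have hle : (G.induce M).chromaticNumber.toNat ≤ Fintype.card M := by
    have := SimpleGraph.chromaticNumber_le_card (G := G.induce M)
    rw [← hcast] at this
    exact_mod_cast this
  have hne : (G.induce M).chromaticNumber.toNat ≠ Fintype.card M := by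
    intro h
    rw [h] at hcast
    have htop := SimpleGraph.eq_top_of_chromaticNumber_eq_card hcast.symm
    have : (G.induce M).Adj ⟨x, hx⟩ ⟨y, hy⟩ := by
      rw [htop]
      exact fun h => hxy (congrArg Subtype.val h)
    exact hadj this
  have hsum : Nat.card M + Nat.card (Mᶜ : Set V) = Nat.card V := by
    rw [Nat.card_coe_set_eq, Nat.card_coe_set_eq, Set.ncard_add_ncard_compl]
  rw [Nat.card_sum, Nat.card_fin]
  rw [Nat.card_eq_fintype_card] at hsum
  omega

end Blowup

/-! ### The induction on the number of vertices. -/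

theorem mixesAbove_of_inducedFree
    (hyp : ∀ (V : Type u) [Finite V] (G : SimpleGraph V), InducedFree P5 G →
      InducedFree house G → InducedFree C5 G → MixesAbove G)
    {V : Type u} [Finite V] {G : SimpleGraph V} (hP : InducedFree P5 G)
    (hH : InducedFree house G) : MixesAbove G := by
  induction hn : Nat.card V using Nat.strong_induction_on generalizing V with
  | _ n ih =>
  by_cases hC : InducedFree C5 G
  · exact hyp V G hP hH hC
  -- The outside vertex makes G[M] smaller than G; the nonadjacent pair makes the clique replacement
  -- smaller.
  have reduce : ∀ M : Set V, IsModule G M → (∃ v, v ∉ M) →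
      (∃ x ∈ M, ∃ y ∈ M, x ≠ y ∧ ¬ G.Adj x y) → MixesAbove G := by
    rintro M hM ⟨v, hv⟩ ⟨x, hx, y, hy, hxy, hadj⟩
    refine hM.mixesAbove (SimpleGraph.colorable_chromaticNumber_of_fintype _)
      (fun n hn => ENat.toNat_le_of_le_natCast hn.chromaticNumber_le) ?_ ?_
    · refine ih _ ?_ (hP.induce M) (hH.induce M) rfl
      rw [← hn]
      exact Finite.card_subtype_lt hv
    · refine ih _ ?_ (hM.inducedFree_cliqueReplace noTwins_P5 ⟨x, hx⟩ hP)
        (hM.inducedFree_cliqueReplace noTwins_house ⟨x, hx⟩ hH) rfl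
      rw [← hn]
      exact card_cliqueReplace_lt hx hy hxy hadj
  obtain ⟨c, hc, hmax⟩ := exists_maximal_isBlowup hC
  have hmod := hc.isModule hP hH hmax
  choose t ht using hc.exists_label
  by_cases huniv : ∀ v, c v ≠ none
  · by_cases hclique : ∀ u v i, c u = some i → c v = some i → u ≠ v → G.Adj u v
    · exact (hc.noIndepTriple huniv hclique).mixesAbove
    · push Not at hclique
      obtain ⟨u, v, i, hu, hv, huv, hadj⟩ := hclique
      refine reduce _ (hc.isModule_part huniv i) ⟨t (i + 1), ?_⟩ ⟨u, hu, v, hv, huv, hadj⟩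
      intro h
      have h : some (i + 1) = some i := (ht _).symm.trans h
      rw [Option.some_inj] at h
      simp at h
  · push Not at huniv
    obtain ⟨v, hv⟩ := huniv
    -- Positions 0 and 2 are nonadjacent on the 5-cycle.
    refine reduce _ hmod ⟨v, fun h => h hv⟩
      ⟨t 0, by simp [ht], t 2, by simp [ht], ?_, ?_⟩
    · intro h
      have := (ht 0).symm.trans ((congrArg c h).trans (ht 2))
      simp at this
    · rw [hc.adj_iff _ _ 0 2 (ht 0) (ht 2) (by decide), C5_adj]
      decide

end Recoloring

theorem theorem7 :
    (∀ (V : Type u) [Finite V] (G : SimpleGraph V),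
        Recoloring.InducedFree Recoloring.P5 G → Recoloring.InducedFree Recoloring.house G →
          Recoloring.IsRecolorable G) ↔
      (∀ (V : Type u) [Finite V] (G : SimpleGraph V),
        Recoloring.InducedFree Recoloring.P5 G → Recoloring.InducedFree Recoloring.house G →
          Recoloring.InducedFree Recoloring.C5 G → Recoloring.IsRecolorable G) := by
  constructor
  · intro h V _ G hP hH _
    exact h V G hP hH
  · intro h V _ G hP hH
    refine Recoloring.isRecolorable_iff_mixesAbove.2
      (Recoloring.mixesAbove_of_inducedFree (fun W _ F hP hH hC => ?_) hP hH)
    exact Recoloring.isRecolorable_iff_mixesAbove.1 (h W F hP hH hC)
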